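/- Let $p\ge 1$ and $\Omega=\mathbb R^p$ with its Euclidean norm. Let $\mathcal P_2^{\mathrm{Leb}}([0,1]\times\Omega)$ be the set of Borel probability measures $\mu$ on $[0,1]\times\Omega$ with finite second moment whose marginal on $[0,1]$ is the Lebesgue measure. Every such $\mu$ has a disintegration $\mu(\mathrm ds,\mathrm d\omega)=\mu(\mathrm d\omega|s)\,\mathrm ds$, where $s\mapsto\mu(\cdot|s)$ is a measurable family of Borel probability measures on $\Omega$, unique up to a Lebesgue-null set of $s$. For Borel probability measures $\alpha,\beta$ on $\Omega$ let $$\mathcal W_2(\alpha,\beta)=\inf_{\gamma\in\Gamma(\alpha,\beta)}\Big(\int_{\Omega\times\Omega}\|\omega-\omega'\|^2\,\mathrm d\gamma(\omega,\omega')\Big)^{1/2}\in[0,\infty],$$ where $\Gamma(\alpha,\beta)$ is the set of Borel probability measures on $\Omega\times\Omega$ with marginals $\alpha$ and $\beta$. Define, for $\mu,\mu'\in\mathcal P_2^{\mathrm{Leb}}([0,1]\times\Omega)$, $$d(\mu,\mu')=\Big(\int_0^1\mathcal W_2\big(\mu(\cdot|s),\mu'(\cdot|s)\big)^2\,\mathrm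 ds\Big)^{1/2}.$$ **Proposition.** $(\mathcal P_2^{\mathrm{Leb}}([0,1]\times\Omega),d)$ is a complete metric space. That is, for all $\mu,\mu'\in\mathcal P_2^{\mathrm{Leb}}([0,1]\times\Omega)$ the function $s\mapsto\mathcal W_2(\mu(\cdot|s),\mu'(\cdot|s))$ is measurable (so that the integral defining $d$ makes sense), $d$ takes finite values and is a metric on $\mathcal P_2^{\mathrm{Leb}}([0,1]\times\Omega)$, and every $d$-Cauchy sequence converges with respect to $d$ to an element of $\mathcal P_2^{\mathrm{Leb}}([0,1]\times\Omega)$. -/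

import Mathlib

open MeasureTheory ProbabilityTheory
open scoped ENNReal unitInterval

noncomputable section

/-- A measure on a metric space has a finite moment of order two: `∫ d(x, x₀)² dμ(x) < ∞` for some
base point `x₀`. For a finite measure the choice of the base point is irrelevant, and so
is the choice between equivalent metrics (such as the sup metric and the Euclidean metric on
a product). -/
def HasFiniteSecondMoment {X : Type*} [PseudoEMetricSpace X] [MeasurableSpace X]
    (μ : Measure X) : Prop :=
  ∃ x₀ : X, ∫⁻ x, edist x x₀ ^ 2 ∂μ < ∞

/-- The couplings of `μ` and `ν`: probability measures on `X × X` with marginals `μ` and `ν`. -/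
def couplings {X : Type*} [MeasurableSpace X] (μ ν : Measure X) : Set (Measure (X × X)) :=
  {γ | IsProbabilityMeasure γ ∧ γ.map Prod.fst = μ ∧ γ.map Prod.snd = ν}

/-- The quadratic Wasserstein distance, with values in `[0, ∞]`; it is finite when both measures
are probability measures with finite second moment. -/
def wasserstein2 {X : Type*} [PseudoEMetricSpace X] [MeasurableSpace X]
    (μ ν : Measure X) : ℝ≥0∞ :=
  ⨅ γ ∈ couplings μ ν, (∫⁻ z, edist z.1 z.2 ^ 2 ∂γ) ^ (1 / 2 : ℝ)

/-- The probability measures on `[0, 1] × ℝᵖ` with finite second moment whose first marginal is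
the Lebesgue measure on `[0, 1]`. -/
@[ext]
structure P2Leb (p : ℕ) where
  /-- The underlying Borel measure. -/
  toMeasure : Measure (I × EuclideanSpace ℝ (Fin p))
  isProbabilityMeasure : IsProbabilityMeasure toMeasure
  hasFiniteSecondMoment : HasFiniteSecondMoment toMeasure
  map_fst : toMeasure.map Prod.fst = (volume : Measure I)

instance {p : ℕ} (μ : P2Leb p) : IsProbabilityMeasure μ.toMeasure := μ.isProbabilityMeasure

/-- The disintegration `s ↦ μ(·|s)` of `μ` with respect to the Lebesgue measure on `[0, 1]`:
a Markov kernel, characterized up to a null set of `s` by `μ(ds, dω) = μ(dω|s) ds`. -/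
def P2Leb.disintegration {p : ℕ} (μ : P2Leb p) : Kernel I (EuclideanSpace ℝ (Fin p)) :=
  μ.toMeasure.condKernel

theorem P2Leb.compProd_disintegration {p : ℕ} (μ : P2Leb p) :
    (volume : Measure I).compProd μ.disintegration = μ.toMeasure := by
  have h := μ.toMeasure.disintegrate μ.toMeasure.condKernel
  rwa [Measure.fst, μ.map_fst] at h

/-- The Conditional Optimal Transport distance
`d(μ, ν) = (∫₀¹ W₂(μ(·|s), ν(·|s))² ds)^(1/2)`, with values in `[0, ∞]`. -/
def condOTDist {p : ℕ} (μ ν : P2Leb p) : ℝ≥0∞ :=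
  (∫⁻ s : I, wasserstein2 (μ.disintegration s) (ν.disintegration s) ^ 2) ^ (1 / 2 : ℝ)

end

/-!
The distance `condOTDist` is the `L²([0, 1])` distance between the families of conditional measures,
with the values compared by the quadratic Wasserstein distance `W₂`. The metric axioms and
completeness are obtained by applying the properties of `W₂` for almost every `s`.

The central fact is that `W₂` is lower semicontinuous for weak convergence on pairs of probability
measures of a Polish space (`lowerSemicontinuous_wasserstein2`). By Prokhorov's theorem the map
sending a measure on `X × X` to its pair of marginals is proper (`isProperMap_marginals`), and the
transport cost is lower semicontinuous; hence optimal couplings exist and the sublevel sets of `W₂`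
are closed. Since the space of probability measures is second countable and its weakly open sets
are measurable for the Giry `σ`-algebra, `s ↦ W₂(μ(·|s), ν(·|s))` is measurable for every pair of
Markov kernels (`measurable_wasserstein2`).

The triangle inequality for `W₂` comes from gluing couplings, and passes to `condOTDist` by
Minkowski's inequality. If `condOTDist μ ν = 0` then the conditional measures agree almost
everywhere, so `μ = ν`. Finiteness is the comparison with the family constantly equal to `δ₀`.

For completeness it suffices to treat a sequence with summable successive distances. For almost
every `s`, the successive `W₂`-distances of the conditional measures are then summable, so their
second moments are bounded. In a proper space this gives tightness, and lower semicontinuity leaves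
only one cluster point (`exists_tendsto_of_tsum_wasserstein2_ne_top`). The weak limits form a
measurable kernel, and Fatou's lemma with lower semicontinuity shows that the measure built from it
is the limit for `condOTDist`.
-/

open Filter Set TopologicalSpace
open scoped Topology NNReal

/-! ### The space of probability measures: separability and measurability -/

namespace MeasureTheory.ProbabilityMeasure

section Countability

variable {X : Type*} [MetricSpace X] [SecondCountableTopology X] [MeasurableSpace X]
  [BorelSpace X]

/-- Probability measures supported in `{e 0, …, e N}`, where `e` enumerates a dense sequence, form
a separable set (an image of the probability measures on `Fin (N + 1)`, which form a compact
metrizable space). Every probability measure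
`μ` is the weak limit of its images under the nearest point maps to `{e 0, …, e N}`. -/
instance separableSpace : SeparableSpace (ProbabilityMeasure X) := by
  rcases isEmpty_or_nonempty X with hX | hX
  · have : IsEmpty (ProbabilityMeasure X) :=
      ⟨fun μ => (not_isEmpty_iff.2 μ.nonempty) hX⟩
    infer_instance
  let e := denseSeq X
  let g : ∀ N : ℕ, Fin (N + 1) → X := fun N i => e i
  have hg : ∀ N, Continuous (g N) := fun N => continuous_of_discreteTopology
  let S : ∀ N : ℕ, Set (ProbabilityMeasure X) := fun N =>
    range fun ν : ProbabilityMeasure (Fin (N + 1)) => ν.map (hg N).measurable.aemeasurable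
  have hS : TopologicalSpace.IsSeparable (⋃ N, S N) := .iUnion fun N =>
    isSeparable_range (continuous_map (hg N))
  suffices h : closure (⋃ N, S N) = univ by
    rw [← isSeparable_univ_iff, ← h]; exact hS.closure
  refine eq_univ_of_forall fun μ => ?_
  let T : ℕ → X → X := fun N => SimpleFunc.nearestPt e N
  have hT : ∀ N, Measurable (T N) := fun N => (SimpleFunc.nearestPt e N).measurable
  refine mem_closure_of_tendsto (f := fun N => μ.map (hT N).aemeasurable) (b := atTop) ?_
    (Eventually.of_forall fun N => mem_iUnion.2 ⟨N, ?_⟩)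
  · rw [tendsto_iff_forall_integral_tendsto]
    intro f
    have : ∀ N, ∫ x, f x ∂(μ.map (hT N).aemeasurable : Measure X) = ∫ x, f (T N x) ∂μ := fun N =>
      integral_map (hT N).aemeasurable f.continuous.measurable.aestronglyMeasurable
    simp_rw [this]
    refine tendsto_integral_of_dominated_convergence (fun _ => ‖f‖)
      (fun N => (f.continuous.measurable.comp (hT N)).aestronglyMeasurable) (integrable_const _)
      (fun N => ae_of_all _ fun x => f.norm_coe_le_norm _) (ae_of_all _ fun x => ?_)
    refine (f.continuous.tendsto x).comp (SimpleFunc.tendsto_nearestPt ?_)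
    rw [(denseRange_denseSeq X).closure_range]
    trivial
  · let ind : X → Fin (N + 1) := fun x =>
      ⟨SimpleFunc.nearestPtInd e N x, Nat.lt_succ_of_le (SimpleFunc.nearestPtInd_le e N x)⟩
    have hind : Measurable ind := by
      refine measurable_to_countable' fun i => ?_
      have : ind ⁻¹' {i} = SimpleFunc.nearestPtInd e N ⁻¹' {(i : ℕ)} := by
        ext x; simp [ind, Fin.ext_iff]
      rw [this]
      exact (SimpleFunc.nearestPtInd e N).measurableSet_fiber _
    refine ⟨μ.map hind.aemeasurable, ?_⟩
    apply Subtype.ext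
    change ((μ : Measure X).map ind).map (g N) = (μ : Measure X).map (T N)
    rw [Measure.map_map (hg N).measurable hind]
    rfl

instance secondCountableTopology : SecondCountableTopology (ProbabilityMeasure X) := by
  let := metrizableSpaceMetric (ProbabilityMeasure X)
  exact UniformSpace.secondCountable_of_separable _

/-- Weakly open sets are measurable for the `σ`-algebra generated by the evaluations: the weak
topology is second countable and generated by the sets `{μ | ∫ f dμ ∈ U}`. -/
instance opensMeasurableSpace : OpensMeasurableSpace (ProbabilityMeasure X) := by
  let S : Set (Set (ProbabilityMeasure X)) :=
    {s | ∃ (f : BoundedContinuousFunction X ℝ≥0) (U : Set ℝ≥0∞), IsOpen U ∧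
      s = (fun μ : ProbabilityMeasure X => ∫⁻ x, f x ∂(μ : Measure X)) ⁻¹' U}
  have hS : (inferInstance : TopologicalSpace (ProbabilityMeasure X)) = generateFrom S := by
    refine le_antisymm (le_generateFrom ?_) (continuous_id_iff_le.1 ?_)
    · rintro _ ⟨f, U, hU, rfl⟩
      exact hU.preimage (continuous_lintegral_boundedContinuousFunction f)
    -- `generateFrom S` makes all integrals of bounded continuous functions continuous, so it is
    -- finer than the weak topology.
    · refine (@continuous_iff_forall_continuous_lintegral X _ _ _ _ (generateFrom S) id).2
        fun f => ?_
      refine @Continuous.mk _ _ (generateFrom S) _ _ fun U hU => ?_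
      exact isOpen_generateFrom_of_mem ⟨f, U, hU, rfl⟩
  refine ⟨?_⟩
  rw [borel_eq_generateFrom_of_subbasis hS]
  refine MeasurableSpace.generateFrom_le ?_
  rintro _ ⟨f, U, hU, rfl⟩
  have : Measurable fun μ : Measure X => ∫⁻ x, f x ∂μ :=
    Measure.measurable_lintegral f.continuous.measurable.coe_nnreal_ennreal
  exact (this.comp measurable_subtype_coe) hU.measurableSet

end Countability

/-- A family of probability measures is measurable as soon as its integrals against bounded
continuous functions are. -/
theorem measurable_of_forall_lintegral {S X : Type*} [MeasurableSpace S] [TopologicalSpace X]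
    [HasOuterApproxClosed X] [MeasurableSpace X] [BorelSpace X] {μ : S → ProbabilityMeasure X}
    (h : ∀ f : BoundedContinuousFunction X ℝ≥0,
      Measurable fun s => ∫⁻ x, f x ∂(μ s : Measure X)) :
    Measurable fun s => (μ s : Measure X) := by
  refine .measure_of_isPiSystem_of_isProbabilityMeasure
    (BorelSpace.measurable_eq.trans borel_eq_generateFrom_isClosed) isPiSystem_isClosed
    fun F hF => ?_
  exact measurable_of_tendsto_metrizable (fun n => h (IsClosed.apprSeq hF n))
    (tendsto_pi_nhds.2 fun s => HasOuterApproxClosed.tendsto_lintegral_apprSeq hF (μ s : Measure X))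

/-- Integration of a continuous `[0, ∞]`-valued function is lower semicontinuous: it is the
supremum of the integrals of the bounded truncations. -/
theorem lowerSemicontinuous_lintegral {X : Type*} [TopologicalSpace X] [MeasurableSpace X]
    [OpensMeasurableSpace X] {f : X → ℝ≥0∞} (hf : Continuous f) :
    LowerSemicontinuous fun μ : ProbabilityMeasure X => ∫⁻ x, f x ∂(μ : Measure X) := by
  have hne : ∀ (n : ℕ) x, min (f x) n ≠ ∞ := fun n x =>
    ne_top_of_le_ne_top (ENNReal.natCast_ne_top n) (min_le_right _ _)
  have hle : ∀ (n : ℕ) x, (min (f x) n).toNNReal ≤ n := fun n x =>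
    ENNReal.coe_le_coe.1 (by rw [ENNReal.coe_toNNReal (hne n x)]; exact min_le_right _ _)
  let F : ℕ → BoundedContinuousFunction X ℝ≥0 := fun n =>
    BoundedContinuousFunction.mkOfBound
      ⟨fun x => (min (f x) n).toNNReal,
        continuous_iff_continuousAt.2 fun x => (ENNReal.tendsto_toNNReal (hne n x)).comp
          (hf.min continuous_const).continuousAt⟩ n fun x y => by
        rw [NNReal.dist_eq]
        exact abs_sub_le_of_nonneg_of_le (NNReal.coe_nonneg _) (by exact_mod_cast hle n x)
          (NNReal.coe_nonneg _) (by exact_mod_cast hle n y)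
  have hF : ∀ n x, (F n x : ℝ≥0∞) = min (f x) n := fun n x => ENNReal.coe_toNNReal (hne n x)
  have hsup : ∀ x, f x = ⨆ n : ℕ, (F n x : ℝ≥0∞) := fun x => by
    simp_rw [hF]
    have := inf_iSup_eq (f x) (fun n : ℕ => (n : ℝ≥0∞))
    rw [ENNReal.iSup_natCast, inf_top_eq] at this
    exact this
  have : (fun μ : ProbabilityMeasure X => ∫⁻ x, f x ∂(μ : Measure X)) =
      fun μ : ProbabilityMeasure X => ⨆ n, ∫⁻ x, F n x ∂(μ : Measure X) := by
    funext μ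
    rw [← lintegral_iSup (fun n => (F n).continuous.measurable.coe_nnreal_ennreal)]
    · exact lintegral_congr hsup
    · intro m n hmn x
      simp only [hF]
      gcongr
  rw [this]
  exact lowerSemicontinuous_iSup fun n =>
    (continuous_lintegral_boundedContinuousFunction (F n)).lowerSemicontinuous

end MeasureTheory.ProbabilityMeasure

/-! ### Optimal couplings and lower semicontinuity of the Wasserstein distance -/

section Wasserstein

variable {X : Type*} [MeasurableSpace X]

/-- The pair of marginals of a probability measure on `X × X`. -/
noncomputable def marginals (γ : ProbabilityMeasure (X × X)) :
    ProbabilityMeasure X × ProbabilityMeasure X :=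
  (γ.map measurable_fst.aemeasurable, γ.map measurable_snd.aemeasurable)

theorem marginals_eq_iff {γ : ProbabilityMeasure (X × X)} {α β : ProbabilityMeasure X} :
    marginals γ = (α, β) ↔ (γ : Measure (X × X)) ∈ couplings (α : Measure X) (β : Measure X) := by
  rw [marginals, Prod.mk.injEq, couplings]
  constructor
  · rintro ⟨rfl, rfl⟩
    exact ⟨inferInstance, rfl, rfl⟩
  · rintro ⟨-, h1, h2⟩
    exact ⟨Subtype.ext h1, Subtype.ext h2⟩

theorem prod_mem_couplings (μ ν : Measure X) [IsProbabilityMeasure μ] [IsProbabilityMeasure ν] :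
    μ.prod ν ∈ couplings μ ν :=
  ⟨inferInstance, by simp [Measure.map_fst_prod], by simp [Measure.map_snd_prod]⟩

theorem wasserstein2_le [PseudoEMetricSpace X] {μ ν : Measure X} {γ : Measure (X × X)}
    (hγ : γ ∈ couplings μ ν) :
    wasserstein2 μ ν ≤ (∫⁻ z, edist z.1 z.2 ^ 2 ∂γ) ^ (1 / 2 : ℝ) :=
  iInf₂_le γ hγ

variable [MetricSpace X] [SecondCountableTopology X] [BorelSpace X]

theorem continuous_marginals : Continuous (marginals (X := X)) :=
  (ProbabilityMeasure.continuous_map continuous_fst).prodMk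
    (ProbabilityMeasure.continuous_map continuous_snd)

theorem lowerSemicontinuous_cost : LowerSemicontinuous fun γ : ProbabilityMeasure (X × X) =>
    (∫⁻ z, edist z.1 z.2 ^ 2 ∂(γ : Measure (X × X))) ^ (1 / 2 : ℝ) :=
  Continuous.comp_lowerSemicontinuous (ENNReal.continuous_rpow_const)
    (ProbabilityMeasure.lowerSemicontinuous_lintegral
      (((ENNReal.continuous_pow 2).comp continuous_edist)))
    fun _ _ h => ENNReal.rpow_le_rpow h (by norm_num)

variable [CompleteSpace X]

/-- Measures on `X × X` whose two marginals range in compact sets of measures form a tight set, so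
Prokhorov's theorem applies to them. -/
theorem isProperMap_marginals : IsProperMap (marginals (X := X)) := by
  refine isProperMap_iff_isCompact_preimage.2 ⟨continuous_marginals, fun K hK => ?_⟩
  rw [← (hK.isClosed.preimage continuous_marginals).closure_eq]
  refine isCompact_closure_of_isTightMeasureSet
    (isTightMeasureSet_iff_exists_isCompact_measure_compl_le.2 fun ε hε => ?_)
  have tight : ∀ K : Set (ProbabilityMeasure X), IsCompact K →
      ∃ C : Set X, IsCompact C ∧ ∀ μ ∈ K, (μ : Measure X) Cᶜ ≤ ε / 2 := fun K hK => by
    obtain ⟨C, hC, h⟩ := isTightMeasureSet_iff_exists_isCompact_measure_compl_le.1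
      (isTightMeasureSet_of_isCompact_closure hK.closure) (ε / 2) (ENNReal.half_pos hε.ne')
    exact ⟨C, hC, fun μ hμ => h _ ⟨μ, hμ, rfl⟩⟩
  obtain ⟨C₁, hC₁, h₁⟩ := tight _ (hK.image continuous_fst)
  obtain ⟨C₂, hC₂, h₂⟩ := tight _ (hK.image continuous_snd)
  refine ⟨C₁ ×ˢ C₂, hC₁.prod hC₂, ?_⟩
  rintro _ ⟨γ, hγ, rfl⟩
  have h₁' := h₁ _ ⟨_, hγ, rfl⟩
  have h₂' := h₂ _ ⟨_, hγ, rfl⟩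
  simp only [marginals, ProbabilityMeasure.toMeasure_map] at h₁' h₂'
  rw [Measure.map_apply measurable_fst hC₁.isClosed.measurableSet.compl] at h₁'
  rw [Measure.map_apply measurable_snd hC₂.isClosed.measurableSet.compl] at h₂'
  calc (γ : Measure (X × X)) (C₁ ×ˢ C₂)ᶜ
      ≤ (γ : Measure (X × X)) (Prod.fst ⁻¹' C₁ᶜ ∪ Prod.snd ⁻¹' C₂ᶜ) := by
        refine measure_mono fun z hz => ?_
        simp only [mem_compl_iff, mem_prod, not_and_or] at hz
        exact hz
    _ ≤ ε / 2 + ε / 2 := (measure_union_le _ _).trans (add_le_add h₁' h₂')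
    _ = ε := ENNReal.add_halves ε

/-- Optimal couplings exist: the couplings of two given measures form a fiber of the proper map
`marginals`, hence a compact set, and the cost is lower semicontinuous. -/
theorem exists_coupling_eq_wasserstein2 (μ ν : Measure X) [hμ : IsProbabilityMeasure μ]
    [hν : IsProbabilityMeasure ν] : ∃ γ ∈ couplings μ ν,
      wasserstein2 μ ν = (∫⁻ z, edist z.1 z.2 ^ 2 ∂γ) ^ (1 / 2 : ℝ) := by
  let α : ProbabilityMeasure X := ⟨μ, hμ⟩
  let β : ProbabilityMeasure X := ⟨ν, hν⟩
  have hne : (marginals ⁻¹' {(α, β)}).Nonempty :=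
    ⟨⟨μ.prod ν, inferInstance⟩, marginals_eq_iff.2 (prod_mem_couplings μ ν)⟩
  obtain ⟨γ, hγ, hmin⟩ := (lowerSemicontinuous_cost.lowerSemicontinuousOn _).exists_isMinOn hne
    (isProperMap_marginals.isCompact_preimage isCompact_singleton)
  have hγ' : (γ : Measure (X × X)) ∈ couplings μ ν := marginals_eq_iff.1 hγ
  refine ⟨γ, hγ', le_antisymm (wasserstein2_le hγ') (le_iInf₂ fun γ' hγ'' => ?_)⟩
  exact hmin (a := ⟨γ', hγ''.1⟩)
    (marginals_eq_iff (γ := ⟨γ', hγ''.1⟩) (α := α) (β := β) |>.2 hγ'')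

/-- The sublevel sets of `W₂` are images of closed sets of couplings under the proper map
`marginals`. -/
theorem lowerSemicontinuous_wasserstein2 :
    LowerSemicontinuous fun q : ProbabilityMeasure X × ProbabilityMeasure X =>
      wasserstein2 (q.1 : Measure X) (q.2 : Measure X) := by
  refine lowerSemicontinuous_iff_isClosed_preimage.2 fun t => ?_
  convert! isProperMap_marginals.isClosedMap _
    ((lowerSemicontinuous_cost (X := X)).isClosed_preimage t) using 1
  ext ⟨α, β⟩
  simp only [mem_preimage, mem_Iic, mem_image, marginals_eq_iff]
  constructor
  · intro h
    obtain ⟨γ, hγ, h'⟩ := exists_coupling_eq_wasserstein2 (α : Measure X) (β : Measure X)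
    exact ⟨⟨γ, hγ.1⟩, h'.ge.trans h, hγ⟩
  · rintro ⟨γ, hγ, hγ'⟩
    exact (wasserstein2_le hγ').trans hγ

theorem wasserstein2_sq_le_liminf (α : ProbabilityMeasure X) {β : ℕ → ProbabilityMeasure X}
    {β' : ProbabilityMeasure X} (h : Tendsto β atTop (𝓝 β')) :
    wasserstein2 (α : Measure X) β' ^ 2 ≤
      liminf (fun m => wasserstein2 (α : Measure X) (β m) ^ 2) atTop := by
  have hlsc : LowerSemicontinuous fun q : ProbabilityMeasure X × ProbabilityMeasure X =>
      wasserstein2 (q.1 : Measure X) (q.2 : Measure X) ^ 2 :=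
    (ENNReal.continuous_pow 2).comp_lowerSemicontinuous lowerSemicontinuous_wasserstein2
      fun _ _ h => pow_le_pow_left' h 2
  have ht : Tendsto (fun m => (α, β m)) atTop (𝓝 (α, β')) := tendsto_const_nhds.prodMk_nhds h
  have h1 := LowerSemicontinuous.le_liminf hlsc (α, β')
  have h2 := liminf_le_liminf_of_le ht (u := fun q : ProbabilityMeasure X × ProbabilityMeasure X =>
      wasserstein2 (q.1 : Measure X) (q.2 : Measure X) ^ 2)
  rw [← liminf_comp] at h2
  simpa only [Function.comp_def] using h1.trans h2

/-- The values of a Markov kernel, bundled as probability measures. -/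
def ProbabilityTheory.Kernel.law {S X : Type*} [MeasurableSpace S] [MeasurableSpace X]
    (κ : Kernel S X) [IsMarkovKernel κ] (s : S) : ProbabilityMeasure X :=
  ⟨κ s, inferInstance⟩

theorem ProbabilityTheory.Kernel.coe_law {S X : Type*} [MeasurableSpace S] [MeasurableSpace X]
    (κ : Kernel S X) [IsMarkovKernel κ] (s : S) : (κ.law s : Measure X) = κ s := rfl

theorem ProbabilityTheory.Kernel.measurable_law {S X : Type*} [MeasurableSpace S]
    [MeasurableSpace X] (κ : Kernel S X) [IsMarkovKernel κ] : Measurable κ.law :=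
  Measurable.subtype_mk κ.measurable

/-- Measurability holds at every `s`, without assuming finite second moments: a lower semicontinuous
function on the second countable space of pairs of probability measures is measurable. -/
theorem measurable_wasserstein2 {S : Type*} [MeasurableSpace S] (κ η : Kernel S X)
    [IsMarkovKernel κ] [IsMarkovKernel η] : Measurable fun s => wasserstein2 (κ s) (η s) := by
  have h : Measurable fun q : ProbabilityMeasure X × ProbabilityMeasure X =>
      wasserstein2 (q.1 : Measure X) (q.2 : Measure X) :=
    lowerSemicontinuous_wasserstein2.measurable
  simpa only [Function.comp_def, Kernel.coe_law] using
    h.comp (κ.measurable_law.prodMk η.measurable_law)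

/-- An optimal coupling of zero cost is concentrated on the diagonal. -/
theorem eq_of_wasserstein2_eq_zero {μ ν : Measure X} [IsProbabilityMeasure μ]
    [IsProbabilityMeasure ν] (h : wasserstein2 μ ν = 0) : μ = ν := by
  obtain ⟨γ, ⟨_, h1, h2⟩, hγ⟩ := exists_coupling_eq_wasserstein2 μ ν
  rw [h, eq_comm, ENNReal.rpow_eq_zero_iff_of_pos (by norm_num),
    lintegral_eq_zero_iff (by fun_prop)] at hγ
  rw [← h1, ← h2]
  refine Measure.map_congr ?_
  filter_upwards [hγ] with z hz
  simpa using hz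

end Wasserstein

/-! ### The Wasserstein distance as an extended metric -/

/-- Gluing of couplings: two laws on `X × Y` and `Y × Z` with the same marginal `ν` on `Y` are
marginals of a single law on `Y × X × Z`. The law constructed here makes the `X` and `Z` coordinates
conditionally independent given the `Y` coordinate. -/
theorem exists_gluing {X Y Z : Type*} [MeasurableSpace X] [MeasurableSpace Y] [MeasurableSpace Z]
    [StandardBorelSpace X] [StandardBorelSpace Z] [Nonempty X] [Nonempty Z] {ν : Measure Y}
    {γ₁ : Measure (X × Y)} {γ₂ : Measure (Y × Z)} [IsFiniteMeasure γ₁] [IsFiniteMeasure γ₂]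
    (h₁ : γ₁.map Prod.snd = ν) (h₂ : γ₂.map Prod.fst = ν) :
    ∃ m : Measure (Y × X × Z), m.map (fun q => (q.2.1, q.1)) = γ₁ ∧
      m.map (fun q => (q.1, q.2.2)) = γ₂ := by
  have hfin : IsFiniteMeasure ν := h₂ ▸ inferInstance
  have e₁ : ν ⊗ₘ (γ₁.map Prod.swap).condKernel = γ₁.map Prod.swap := by
    have h := (γ₁.map Prod.swap).disintegrate (γ₁.map Prod.swap).condKernel
    rwa [Measure.fst, Measure.map_map measurable_fst measurable_swap,
      show Prod.fst ∘ Prod.swap = (Prod.snd : X × Y → Y) from rfl, h₁] at h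
  have e₂ : ν ⊗ₘ γ₂.condKernel = γ₂ := by
    have h := γ₂.disintegrate γ₂.condKernel
    rwa [Measure.fst, h₂] at h
  refine ⟨ν ⊗ₘ ((γ₁.map Prod.swap).condKernel ×ₖ γ₂.condKernel), ?_, ?_⟩
  · have : (fun q : Y × X × Z => (q.2.1, q.1)) = Prod.swap ∘ Prod.map id Prod.fst := rfl
    rw [this, ← Measure.map_map measurable_swap (by fun_prop),
      ← Measure.compProd_map measurable_fst, ← Kernel.fst_eq, Kernel.fst_prod, e₁,
      Measure.map_map measurable_swap measurable_swap]
    simp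
  · have : (fun q : Y × X × Z => (q.1, q.2.2)) = Prod.map id Prod.snd := rfl
    rw [this, ← Measure.compProd_map measurable_snd, ← Kernel.snd_eq, Kernel.snd_prod, e₂]

/-- Minkowski's inequality for the `L²` seminorm of `[0, ∞]`-valued functions. -/
theorem lintegral_sq_add_le {S : Type*} [MeasurableSpace S] {μ : Measure S} {f g : S → ℝ≥0∞}
    (hf : AEMeasurable f μ) (hg : AEMeasurable g μ) :
    (∫⁻ s, (f s + g s) ^ 2 ∂μ) ^ (1 / 2 : ℝ) ≤
      (∫⁻ s, f s ^ 2 ∂μ) ^ (1 / 2 : ℝ) + (∫⁻ s, g s ^ 2 ∂μ) ^ (1 / 2 : ℝ) := by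
  have := ENNReal.lintegral_Lp_add_le hf hg (one_le_two (α := ℝ))
  simpa only [Pi.add_apply, ENNReal.rpow_two] using this

theorem rpow_half_sq (a : ℝ≥0∞) : (a ^ (1 / 2 : ℝ)) ^ 2 = a := by
  rw [← ENNReal.rpow_two, ← ENNReal.rpow_mul]
  norm_num

theorem wasserstein2_comm {X : Type*} [PseudoEMetricSpace X] [MeasurableSpace X]
    [OpensMeasurableSpace (X × X)] (μ ν : Measure X) : wasserstein2 μ ν = wasserstein2 ν μ := by
  have key : ∀ μ ν : Measure X, wasserstein2 μ ν ≤ wasserstein2 ν μ := fun μ ν => by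
    refine le_iInf₂ fun γ ⟨_, h1, h2⟩ => ?_
    have hc : γ.map Prod.swap ∈ couplings μ ν :=
      ⟨Measure.isProbabilityMeasure_map measurable_swap.aemeasurable,
        by rw [Measure.map_map measurable_fst measurable_swap]; exact h2,
        by rw [Measure.map_map measurable_snd measurable_swap]; exact h1⟩
    refine (wasserstein2_le hc).trans_eq ?_
    have hm : Measurable fun z : X × X => edist z.1 z.2 ^ 2 :=
      ((ENNReal.continuous_pow 2).comp continuous_edist).measurable
    rw [lintegral_map hm measurable_swap]
    simp only [Prod.fst_swap, Prod.snd_swap, edist_comm]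
  exact le_antisymm (key μ ν) (key ν μ)

section Metric

variable {X : Type*} [MetricSpace X] [SecondCountableTopology X] [MeasurableSpace X] [BorelSpace X]

/-- The only coupling with a Dirac mass is the product, so the distance to a Dirac mass is the
square root of the second moment. -/
theorem wasserstein2_dirac (μ : Measure X) [IsProbabilityMeasure μ] (x₀ : X) :
    wasserstein2 μ (Measure.dirac x₀) = (∫⁻ x, edist x x₀ ^ 2 ∂μ) ^ (1 / 2 : ℝ) := by
  have key : ∀ γ ∈ couplings μ (Measure.dirac x₀),
      ∫⁻ z, edist z.1 z.2 ^ 2 ∂γ = ∫⁻ x, edist x x₀ ^ 2 ∂μ := by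
    rintro γ ⟨_, h1, h2⟩
    have hae : ∀ᵐ z ∂γ, z.2 = x₀ := by
      refine ae_of_ae_map (f := Prod.snd) (p := fun x => x = x₀) measurable_snd.aemeasurable ?_
      rw [h2, ae_dirac_eq]
      rfl
    rw [← h1, lintegral_map (by fun_prop) measurable_fst]
    refine lintegral_congr_ae ?_
    filter_upwards [hae] with z hz
    rw [hz]
  refine le_antisymm ?_ (le_iInf₂ fun γ hγ => (congrArg (· ^ (1 / 2 : ℝ)) (key γ hγ)).ge)
  have hc := prod_mem_couplings μ (Measure.dirac x₀)
  exact (wasserstein2_le hc).trans_eq (congrArg (· ^ (1 / 2 : ℝ)) (key _ hc))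

theorem wasserstein2_self (μ : Measure X) [IsProbabilityMeasure μ] : wasserstein2 μ μ = 0 := by
  have hm : Measurable fun x : X => (x, x) := measurable_id.prodMk measurable_id
  have hc : μ.map (fun x => (x, x)) ∈ couplings μ μ :=
    ⟨Measure.isProbabilityMeasure_map hm.aemeasurable,
      by rw [Measure.map_map measurable_fst hm]; exact Measure.map_id,
      by rw [Measure.map_map measurable_snd hm]; exact Measure.map_id⟩
  refine le_antisymm ((wasserstein2_le hc).trans_eq ?_) zero_le
  rw [lintegral_map (by fun_prop) hm]
  simp

/-- In a proper space, a bound on the second moments implies tightness, since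
closed balls are compact. -/
theorem isCompact_closure_of_wasserstein2_le [ProperSpace X] {S : Set (ProbabilityMeasure X)}
    (x₀ : X) {C : ℝ≥0∞} (hC : C ≠ ∞)
    (hS : ∀ α ∈ S, wasserstein2 (α : Measure X) (Measure.dirac x₀) ≤ C) :
    IsCompact (closure S) := by
  refine isCompact_closure_of_isTightMeasureSet
    (isTightMeasureSet_iff_exists_isCompact_measure_compl_le.2 fun ε hε => ?_)
  obtain ⟨n, hn⟩ : ∃ n : ℕ, C ^ 2 / ε < n :=
    ENNReal.exists_nat_gt (ENNReal.div_lt_top (ENNReal.pow_ne_top hC) hε.ne').ne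
  refine ⟨Metric.closedBall x₀ n, isCompact_closedBall _ _, ?_⟩
  rintro _ ⟨α, hα, rfl⟩
  have h2 : ∫⁻ x, edist x x₀ ^ 2 ∂(α : Measure X) ≤ C ^ 2 := by
    have := pow_le_pow_left' (hS α hα) 2
    rwa [wasserstein2_dirac, rpow_half_sq] at this
  have hsub : (Metric.closedBall x₀ n)ᶜ ⊆ {x | (n : ℝ≥0∞) ≤ edist x x₀ ^ 2} := fun x hx => by
    rw [mem_compl_iff, Metric.mem_closedBall, not_le] at hx
    have h1 : (n : ℝ≥0∞) ≤ edist x x₀ := by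
      rw [edist_dist, ← ENNReal.ofReal_natCast]
      exact ENNReal.ofReal_le_ofReal hx.le
    calc (n : ℝ≥0∞) ≤ (n : ℝ≥0∞) ^ 2 := by exact_mod_cast Nat.le_self_pow two_ne_zero n
      _ ≤ edist x x₀ ^ 2 := by gcongr
  rcases eq_or_ne ε ∞ with rfl | hε'
  · exact le_top
  have hn0 : (n : ℝ≥0∞) ≠ 0 := (zero_le.trans_lt hn).ne'
  calc (α : Measure X) (Metric.closedBall x₀ n)ᶜ
      ≤ (α : Measure X) {x | (n : ℝ≥0∞) ≤ edist x x₀ ^ 2} := measure_mono hsub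
    _ ≤ (∫⁻ x, edist x x₀ ^ 2 ∂(α : Measure X)) / n :=
        meas_ge_le_lintegral_div (by fun_prop) hn0 (ENNReal.natCast_ne_top n)
    _ ≤ C ^ 2 / n := by gcongr
    _ ≤ ε := by
        refine ENNReal.div_le_of_le_mul ?_
        rw [mul_comm]
        exact (ENNReal.div_le_iff hε.ne' hε').1 hn.le

variable [CompleteSpace X]

/-- Gluing two optimal couplings along their common marginal and forgetting the middle coordinate
gives a coupling, whose cost is bounded by Minkowski's inequality. -/
theorem wasserstein2_triangle (μ ν ρ : Measure X) [IsProbabilityMeasure μ] [IsProbabilityMeasure ν]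
    [IsProbabilityMeasure ρ] : wasserstein2 μ ρ ≤ wasserstein2 μ ν + wasserstein2 ν ρ := by
  have : Nonempty X := nonempty_of_isProbabilityMeasure μ
  obtain ⟨γ₁, ⟨_, h11, h12⟩, hγ₁⟩ := exists_coupling_eq_wasserstein2 μ ν
  obtain ⟨γ₂, ⟨_, h21, h22⟩, hγ₂⟩ := exists_coupling_eq_wasserstein2 ν ρ
  obtain ⟨m, hm₁, hm₂⟩ := exists_gluing h12 h21
  have hprob : IsProbabilityMeasure m :=
    (Measure.isProbabilityMeasure_map_iff (f := fun q : X × X × X => (q.2.1, q.1))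
      (by fun_prop)).1 (by rwa [hm₁])
  have hc : m.map (fun q => (q.2.1, q.2.2)) ∈ couplings μ ρ := by
    refine ⟨Measure.isProbabilityMeasure_map (by fun_prop), ?_, ?_⟩
    · rw [← h11, ← hm₁, Measure.map_map (by fun_prop) (by fun_prop),
        Measure.map_map (by fun_prop) (by fun_prop)]
      rfl
    · rw [← h22, ← hm₂, Measure.map_map (by fun_prop) (by fun_prop),
        Measure.map_map (by fun_prop) (by fun_prop)]
      rfl
  rw [hγ₁, hγ₂, ← hm₁, ← hm₂]
  refine (wasserstein2_le hc).trans ?_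
  rw [lintegral_map (by fun_prop) (by fun_prop), lintegral_map (by fun_prop) (by fun_prop),
    lintegral_map (by fun_prop) (by fun_prop)]
  refine le_trans ?_ (lintegral_sq_add_le (by fun_prop) (by fun_prop))
  gcongr with q
  exact edist_triangle _ _ _

/-! ### Completeness of the Wasserstein distance -/

theorem wasserstein2_le_sum (α : ℕ → ProbabilityMeasure X) (n k : ℕ) :
    wasserstein2 (α n : Measure X) (α (n + k)) ≤
      ∑ i ∈ Finset.range k, wasserstein2 (α (n + i) : Measure X) (α (n + i + 1)) := by
  induction k with
  | zero => simp [wasserstein2_self]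
  | succ k ih =>
    rw [Finset.sum_range_succ]
    exact (wasserstein2_triangle _ (α (n + k)) _).trans (by gcongr; exact le_rfl)

/-- A sequence of probability measures with summable successive distances converges weakly: it is
tight, and by lower semicontinuity its Wasserstein distance to any cluster point tends to `0`, so
that there is only one cluster point. -/
theorem exists_tendsto_of_tsum_wasserstein2_ne_top [ProperSpace X] (α : ℕ → ProbabilityMeasure X)
    (x₀ : X) (h₀ : wasserstein2 (α 0 : Measure X) (Measure.dirac x₀) ≠ ∞)
    (hα : ∑' n, wasserstein2 (α n : Measure X) (α (n + 1)) ≠ ∞) :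
    ∃ β : ProbabilityMeasure X, Tendsto α atTop (𝓝 β) := by
  set δ : ℕ → ℝ≥0∞ := fun n => ∑' k, wasserstein2 (α (n + k) : Measure X) (α (n + k + 1))
  have hδ : Tendsto δ atTop (𝓝 0) := by
    convert! ENNReal.tendsto_sum_nat_add _ hα using 2 with n
    simp only [δ, add_comm n]
  have hle : ∀ n k, wasserstein2 (α n : Measure X) (α (n + k)) ≤ δ n := fun n k =>
    (wasserstein2_le_sum α n k).trans (ENNReal.sum_le_tsum _)
  -- The sublevel set `{β | W₂ (α n) β ≤ δ n}` is closed and contains all `α m` with `n ≤ m`.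
  have hcl : ∀ β, MapClusterPt β atTop α → ∀ n, wasserstein2 (α n : Measure X) β ≤ δ n := by
    intro β hβ n
    have hclosed : IsClosed {β : ProbabilityMeasure X | wasserstein2 (α n : Measure X) β ≤ δ n} :=
      (lowerSemicontinuous_wasserstein2.isClosed_preimage (δ n)).preimage
        (Continuous.prodMk_right (α n))
    refine hclosed.mem_of_mapClusterPt hβ ?_
    filter_upwards [eventually_ge_atTop n] with m hm
    obtain ⟨k, rfl⟩ := Nat.exists_eq_add_of_le hm
    exact hle n k
  have hK := isCompact_closure_of_wasserstein2_le (S := range α) x₀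
    (ENNReal.add_ne_top.2 ⟨(?_ : δ 0 ≠ ∞), h₀⟩) <| by
      rintro _ ⟨n, rfl⟩
      refine (wasserstein2_triangle _ (α 0 : Measure X) _).trans ?_
      rw [wasserstein2_comm]
      gcongr
      simpa using hle 0 n
  · have hmem : ∀ n, α n ∈ closure (range α) := fun n => subset_closure (mem_range_self n)
    obtain ⟨β, -, hβ⟩ := hK.exists_mapClusterPt (f := atTop) (u := α)
      (tendsto_principal.2 (Eventually.of_forall hmem))
    refine ⟨β, hK.tendsto_nhds_of_unique_mapClusterPt (Eventually.of_forall hmem)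
      fun β' _ hβ' => ?_⟩
    have h0 : wasserstein2 (β' : Measure X) (β : Measure X) ≤ 0 :=
      ge_of_tendsto' (by simpa using hδ.add hδ) fun n => by
        refine (wasserstein2_triangle (β' : Measure X) (α n : Measure X) (β : Measure X)).trans ?_
        rw [wasserstein2_comm]
        exact add_le_add (hcl β' hβ' n) (hcl β hβ n)
    exact ProbabilityMeasure.toMeasure_injective
      (eq_of_wasserstein2_eq_zero (le_antisymm h0 zero_le))
  · simpa [δ] using hα

end Metric

/-! ### Measures on the product with the unit interval and their disintegrations -/

theorem lintegral_le_sqrt_lintegral_sq {S : Type*} [MeasurableSpace S] {μ : Measure S}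
    [IsProbabilityMeasure μ] {f : S → ℝ≥0∞} (hf : AEMeasurable f μ) :
    ∫⁻ s, f s ∂μ ≤ (∫⁻ s, f s ^ 2 ∂μ) ^ (1 / 2 : ℝ) := by
  have := ENNReal.lintegral_mul_le_Lp_mul_Lq μ Real.HolderConjugate.two_two hf
    (aemeasurable_const (b := (1 : ℝ≥0∞)))
  simpa using this

section Product

variable {E : Type*} [NormedAddCommGroup E] [SecondCountableTopology E] [MeasurableSpace E]
  [BorelSpace E]

/-- The unit interval is bounded, so only the second coordinate matters for the second moment. -/
theorem hasFiniteSecondMoment_iff (μ : Measure (I × E)) [IsProbabilityMeasure μ] :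
    HasFiniteSecondMoment μ ↔ ∫⁻ z, edist z.2 0 ^ 2 ∂μ ≠ ∞ := by
  -- By Minkowski's inequality, adding a constant preserves square integrability.
  have key : ∀ (f g : I × E → ℝ≥0∞) (C : ℝ≥0∞), Measurable f → C ≠ ∞ → (∀ z, g z ≤ f z + C) →
      ∫⁻ z, f z ^ 2 ∂μ ≠ ∞ → ∫⁻ z, g z ^ 2 ∂μ ≠ ∞ := fun f g C hf hC hle hfin => by
    have h := lintegral_sq_add_le (μ := μ) hf.aemeasurable (aemeasurable_const (b := C))
    have hfin' : (∫⁻ z, (f z + C) ^ 2 ∂μ) ^ (1 / 2 : ℝ) ≠ ∞ := by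
      refine ne_top_of_le_ne_top (ENNReal.add_ne_top.2 ⟨?_, ?_⟩) h
      · exact ENNReal.rpow_ne_top_of_nonneg (by norm_num) hfin
      · refine ENNReal.rpow_ne_top_of_nonneg (by norm_num) ?_
        simpa using hC
    rw [← rpow_half_sq (∫⁻ z, g z ^ 2 ∂μ)]
    refine ENNReal.pow_ne_top (ne_top_of_le_ne_top hfin' ?_)
    gcongr with z
    exact hle z
  constructor
  · rintro ⟨x₀, h⟩
    refine key (fun z => edist z x₀) _ (edist x₀.2 0) (by fun_prop) (edist_ne_top _ _)
      (fun z => ?_) h.ne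
    exact (edist_triangle _ x₀.2 _).trans (by gcongr; exact le_max_right _ _)
  · intro h
    refine ⟨(0, 0), lt_top_iff_ne_top.2 (key (fun z => edist z.2 0) _ 1 (by fun_prop)
      ENNReal.one_ne_top (fun z => ?_) h)⟩
    refine max_le ?_ le_self_add
    refine le_trans ?_ le_add_self
    rw [edist_dist, ← ENNReal.ofReal_one, Subtype.dist_eq, Real.dist_eq]
    refine ENNReal.ofReal_le_ofReal ?_
    simpa [abs_of_nonneg z.1.2.1] using z.1.2.2

theorem lintegral_wasserstein2_dirac (κ : Kernel I E) [IsMarkovKernel κ] (x : E) :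
    ∫⁻ s, wasserstein2 (κ s) (Measure.dirac x) ^ 2 =
      ∫⁻ z, edist z.2 x ^ 2 ∂((volume : Measure I).compProd κ) := by
  rw [Measure.lintegral_compProd (by fun_prop)]
  simp_rw [wasserstein2_dirac, rpow_half_sq]

end Product

namespace P2Leb

variable {p : ℕ}

instance isMarkovKernel_disintegration (μ : P2Leb p) : IsMarkovKernel μ.disintegration := by
  rw [disintegration]; infer_instance

theorem lintegral_wasserstein2_dirac_ne_top (μ : P2Leb p) :
    ∫⁻ s : I, wasserstein2 (μ.disintegration s) (Measure.dirac 0) ^ 2 ≠ ∞ := by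
  rw [lintegral_wasserstein2_dirac, μ.compProd_disintegration]
  exact (hasFiniteSecondMoment_iff _).1 μ.hasFiniteSecondMoment

theorem eq_of_disintegration_ae_eq {μ ν : P2Leb p}
    (h : μ.disintegration =ᵐ[volume] ν.disintegration) : μ = ν := by
  ext1
  rw [← μ.compProd_disintegration, ← ν.compProd_disintegration, Measure.compProd_congr h]

/-- Every Markov kernel with integrable second moments is almost everywhere the disintegration of
an element of `P2Leb p`. -/
theorem exists_disintegration_ae_eq (κ : Kernel I (EuclideanSpace ℝ (Fin p))) [IsMarkovKernel κ]
    (hκ : ∫⁻ s : I, wasserstein2 (κ s) (Measure.dirac 0) ^ 2 ≠ ∞) :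
    ∃ μ : P2Leb p, μ.disintegration =ᵐ[volume] κ := by
  refine ⟨⟨(volume : Measure I).compProd κ, inferInstance, ?_, Measure.fst_compProd _ _⟩, ?_⟩
  · rwa [hasFiniteSecondMoment_iff, ← lintegral_wasserstein2_dirac]
  · exact condKernel_compProd _ _

/-! ### The conditional optimal transport distance -/

theorem measurable_wasserstein2_disintegration (μ ν : P2Leb p) :
    Measurable fun s : I => wasserstein2 (μ.disintegration s) (ν.disintegration s) :=
  measurable_wasserstein2 _ _

theorem condOTDist_self (μ : P2Leb p) : condOTDist μ μ = 0 := by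
  simp [condOTDist, wasserstein2_self]

theorem condOTDist_comm (μ ν : P2Leb p) : condOTDist μ ν = condOTDist ν μ := by
  simp only [condOTDist, wasserstein2_comm]

theorem condOTDist_triangle (μ ν ρ : P2Leb p) :
    condOTDist μ ρ ≤ condOTDist μ ν + condOTDist ν ρ := by
  refine le_trans ?_ (lintegral_sq_add_le
    (measurable_wasserstein2_disintegration μ ν).aemeasurable
    (measurable_wasserstein2_disintegration ν ρ).aemeasurable)
  rw [condOTDist]
  gcongr with s
  exact wasserstein2_triangle _ _ _

theorem eq_of_condOTDist_eq_zero {μ ν : P2Leb p} (h : condOTDist μ ν = 0) : μ = ν := by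
  rw [condOTDist, ENNReal.rpow_eq_zero_iff_of_pos (by norm_num), lintegral_eq_zero_iff
    ((measurable_wasserstein2_disintegration μ ν).pow_const 2)] at h
  refine eq_of_disintegration_ae_eq ?_
  filter_upwards [h] with s hs
  exact eq_of_wasserstein2_eq_zero (by simpa using hs)

/-- Comparison with the constant family `δ₀` bounds the distance by the second moments. -/
theorem condOTDist_ne_top (μ ν : P2Leb p) : condOTDist μ ν ≠ ∞ := by
  have hm : ∀ μ : P2Leb p,
      Measurable fun s : I => wasserstein2 (μ.disintegration s) (Measure.dirac 0) :=
    fun μ => measurable_wasserstein2 _ (Kernel.const I (Measure.dirac 0))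
  refine ne_top_of_le_ne_top (ENNReal.add_ne_top.2 ⟨?_, ?_⟩) (le_trans ?_
    (lintegral_sq_add_le (μ := volume) (hm μ).aemeasurable (hm ν).aemeasurable))
  · exact ENNReal.rpow_ne_top_of_nonneg (by norm_num) μ.lintegral_wasserstein2_dirac_ne_top
  · exact ENNReal.rpow_ne_top_of_nonneg (by norm_num) ν.lintegral_wasserstein2_dirac_ne_top
  · rw [condOTDist]
    gcongr with s
    rw [wasserstein2_comm (ν.disintegration s)]
    exact wasserstein2_triangle _ _ _

/-- The conditional optimal transport distance as an extended metric. -/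
noncomputable abbrev condOTEMetricSpace : EMetricSpace (P2Leb p) where
  edist := condOTDist
  edist_self := condOTDist_self
  edist_comm := condOTDist_comm
  edist_triangle := condOTDist_triangle
  eq_of_edist_eq_zero := eq_of_condOTDist_eq_zero

/-- On the probability space `[0, 1]` the `L¹` norm is at most the `L²` norm, so the sum of the
pointwise distances has finite integral. -/
theorem ae_tsum_wasserstein2_ne_top {u : ℕ → P2Leb p}
    (hu : ∑' n, condOTDist (u n) (u (n + 1)) ≠ ∞) :
    ∀ᵐ s : I, ∑' n, wasserstein2 ((u n).disintegration s) ((u (n + 1)).disintegration s) ≠ ∞ := by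
  have hm : ∀ n, Measurable fun s : I =>
      wasserstein2 ((u n).disintegration s) ((u (n + 1)).disintegration s) :=
    fun n => measurable_wasserstein2_disintegration _ _
  have h : ∫⁻ s : I, ∑' n, wasserstein2 ((u n).disintegration s) ((u (n + 1)).disintegration s)
      ≠ ∞ := by
    rw [lintegral_tsum fun n => (hm n).aemeasurable]
    exact ne_top_of_le_ne_top hu
      (ENNReal.tsum_le_tsum fun n => lintegral_le_sqrt_lintegral_sq (hm n).aemeasurable)
  filter_upwards [ae_lt_top (Measurable.tsum hm) h] with s hs using hs.ne

/-- If the successive distances of a sequence are summable, then almost all conditional measures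
converge weakly, and the limits can be chosen as the values of a Markov kernel. -/
theorem exists_kernel_tendsto {u : ℕ → P2Leb p}
    (hu : ∑' n, condOTDist (u n) (u (n + 1)) ≠ ∞) :
    ∃ (κ : Kernel I (EuclideanSpace ℝ (Fin p))) (_ : IsMarkovKernel κ), ∀ᵐ s : I,
      Tendsto (fun n => (u n).disintegration.law s) atTop (𝓝 (κ.law s)) := by
  classical
  let Ω := EuclideanSpace ℝ (Fin p)
  let α : ℕ → I → ProbabilityMeasure Ω := fun n => (u n).disintegration.law
  let δ₀ : ProbabilityMeasure Ω := ⟨Measure.dirac 0, inferInstance⟩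
  -- Off the null set `Gᶜ` the sequence is replaced by the constant `δ₀`, so that the limit exists
  -- everywhere and is measurable.
  let G : Set I := {s | wasserstein2 ((u 0).disintegration s) (Measure.dirac 0) ≠ ∞ ∧
    ∑' n, wasserstein2 ((u n).disintegration s) ((u (n + 1)).disintegration s) ≠ ∞}
  have hm₀ : Measurable fun s : I => wasserstein2 ((u 0).disintegration s) (Measure.dirac 0) :=
    measurable_wasserstein2 _ (Kernel.const I (Measure.dirac 0))
  have hG : MeasurableSet G :=
    (hm₀ (measurableSet_singleton ∞).compl).inter
      ((Measurable.tsum fun n => measurable_wasserstein2_disintegration (u n) (u (n + 1)))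
        (measurableSet_singleton ∞).compl)
  have hGae : ∀ᵐ s : I, s ∈ G := by
    filter_upwards [ae_tsum_wasserstein2_ne_top hu,
      ae_lt_top (hm₀.pow_const 2) (u 0).lintegral_wasserstein2_dirac_ne_top] with s h1 h2
    exact ⟨fun h => by simp [h] at h2, h1⟩
  have hlim : ∀ s, ∃ β : ProbabilityMeasure Ω,
      Tendsto (fun n => if s ∈ G then α n s else δ₀) atTop (𝓝 β) := fun s => by
    by_cases hs : s ∈ G
    · simpa only [hs, if_true] using
        exists_tendsto_of_tsum_wasserstein2_ne_top (fun n => α n s) 0 hs.1 hs.2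
    · exact ⟨δ₀, by simpa only [hs, if_false] using tendsto_const_nhds⟩
  choose β hβ using hlim
  have hβm : Measurable fun s => (β s : Measure Ω) := by
    refine ProbabilityMeasure.measurable_of_forall_lintegral fun f => ?_
    refine measurable_of_tendsto_metrizable (f := fun n s =>
      if s ∈ G then ∫⁻ x, f x ∂((u n).disintegration s) else ∫⁻ x, f x ∂(Measure.dirac 0))
      (fun n => Measurable.ite hG ?_ measurable_const) (tendsto_pi_nhds.2 fun s => ?_)
    · exact f.continuous.measurable.coe_nnreal_ennreal.lintegral_kernel
    · have := ProbabilityMeasure.tendsto_iff_forall_lintegral_tendsto.1 (hβ s) f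
      refine this.congr fun n => ?_
      split_ifs <;> rfl
  refine ⟨⟨fun s => β s, hβm⟩, ⟨fun s => inferInstanceAs (IsProbabilityMeasure (β s : Measure Ω))⟩,
    ?_⟩
  filter_upwards [hGae] with s hs
  have h := hβ s
  simp only [hs, if_true] at h
  exact h

/-- Fatou's lemma combined with the lower semicontinuity of the Wasserstein distance. -/
theorem lintegral_wasserstein2_sq_le_of_tendsto {u : ℕ → P2Leb p}
    {κ : Kernel I (EuclideanSpace ℝ (Fin p))} [IsMarkovKernel κ]
    (hκ : ∀ᵐ s : I, Tendsto (fun n => (u n).disintegration.law s) atTop (𝓝 (κ.law s)))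
    (μ : P2Leb p) {C : ℝ≥0∞} (hC : ∀ᶠ m in atTop, condOTDist μ (u m) ≤ C) :
    (∫⁻ s : I, wasserstein2 (μ.disintegration s) (κ s) ^ 2) ^ (1 / 2 : ℝ) ≤ C := by
  have hle : ∫⁻ s : I, wasserstein2 (μ.disintegration s) (κ s) ^ 2 ≤ C ^ 2 := by
    calc ∫⁻ s : I, wasserstein2 (μ.disintegration s) (κ s) ^ 2
        ≤ ∫⁻ s : I, liminf (fun m =>
            wasserstein2 (μ.disintegration s) ((u m).disintegration s) ^ 2) atTop := by
          refine lintegral_mono_ae ?_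
          filter_upwards [hκ] with s hs
          simpa only [Kernel.coe_law] using
            wasserstein2_sq_le_liminf (μ.disintegration.law s) hs
      _ ≤ liminf (fun m => ∫⁻ s : I,
            wasserstein2 (μ.disintegration s) ((u m).disintegration s) ^ 2) atTop :=
          lintegral_liminf_le fun m => (measurable_wasserstein2_disintegration _ _).pow_const 2
      _ ≤ C ^ 2 := by
          refine liminf_le_of_frequently_le' (hC.mono fun m hm => ?_).frequently
          have := pow_le_pow_left' hm 2
          rwa [condOTDist, rpow_half_sq] at this
  rwa [← rpow_half_sq (∫⁻ s : I, wasserstein2 (μ.disintegration s) (κ s) ^ 2),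
    ENNReal.pow_le_pow_left_iff two_ne_zero] at hle

theorem completeSpace_condOT : @CompleteSpace (P2Leb p) condOTEMetricSpace.toUniformSpace := by
  let := condOTEMetricSpace (p := p)
  refine EMetric.complete_of_convergent_controlled_sequences (fun n => (2⁻¹ : ℝ≥0∞) ^ n)
    (fun n => ENNReal.pow_pos (by simp) n) fun u hu => ?_
  have hsum : ∑' n, condOTDist (u n) (u (n + 1)) ≠ ∞ := by
    refine ne_top_of_le_ne_top ?_
      (ENNReal.tsum_le_tsum fun n => (hu n n (n + 1) le_rfl n.le_succ).le)
    simp [ENNReal.tsum_geometric]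
  obtain ⟨κ, _, hκ⟩ := exists_kernel_tendsto hsum
  have hle : ∀ n, (∫⁻ s : I, wasserstein2 ((u n).disintegration s) (κ s) ^ 2) ^ (1 / 2 : ℝ) ≤
      2⁻¹ ^ n := fun n =>
    lintegral_wasserstein2_sq_le_of_tendsto hκ (u n)
      ((eventually_ge_atTop n).mono fun m hm => (hu n n m le_rfl hm).le)
  have hmom : ∫⁻ s : I, wasserstein2 (κ s) (Measure.dirac 0) ^ 2 ≠ ∞ := by
    have hm₁ := measurable_wasserstein2 κ (u 0).disintegration
    have hm₂ := measurable_wasserstein2 (u 0).disintegration (Kernel.const I (Measure.dirac 0))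
    rw [← rpow_half_sq (∫⁻ s : I, _)]
    refine ENNReal.pow_ne_top (ne_top_of_le_ne_top (ENNReal.add_ne_top.2 ⟨?_, ?_⟩) (le_trans ?_
      (lintegral_sq_add_le (μ := volume) hm₁.aemeasurable hm₂.aemeasurable)))
    · simp_rw [wasserstein2_comm (κ _)]
      exact ne_top_of_le_ne_top (by simp) (hle 0)
    · exact ENNReal.rpow_ne_top_of_nonneg (by norm_num) (u 0).lintegral_wasserstein2_dirac_ne_top
    · gcongr with s
      exact wasserstein2_triangle _ _ _
  obtain ⟨μ, hμ⟩ := exists_disintegration_ae_eq κ hmom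
  refine ⟨μ, tendsto_iff_edist_tendsto_0.2 ?_⟩
  refine tendsto_of_tendsto_of_tendsto_of_le_of_le tendsto_const_nhds
    (ENNReal.tendsto_pow_atTop_nhds_zero_of_lt_one (by simp : (2⁻¹ : ℝ≥0∞) < 1))
    (fun _ => zero_le) fun n => ?_
  refine le_trans (le_of_eq ?_) (hle n)
  change condOTDist _ _ = _
  rw [condOTDist]
  congr 1
  refine lintegral_congr_ae ?_
  filter_upwards [hμ] with s hs
  rw [hs]

end P2Leb

theorem mainTheorem9 (p : ℕ) (hp : 1 ≤ p) :
    (∀ μ ν : P2Leb p,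
      Measurable fun s : I => wasserstein2 (μ.disintegration s) (ν.disintegration s)) ∧
    ∃ _ : MetricSpace (P2Leb p),
      (∀ μ ν : P2Leb p, edist μ ν = condOTDist μ ν) ∧ CompleteSpace (P2Leb p) := by
  refine ⟨P2Leb.measurable_wasserstein2_disintegration, ?_⟩
  let := P2Leb.condOTEMetricSpace (p := p)
  exact ⟨EMetricSpace.toMetricSpace P2Leb.condOTDist_ne_top, fun _ _ => rfl,
    P2Leb.completeSpace_condOT⟩
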